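/- Let $\mathbb B^n=\{z\in\mathbb C^n:\|z\|<1\}$ (Euclidean norm). A map $\mathbb B^n\to\mathbb C^n$ is called univalent if it is holomorphic and injective. A family $(f_t)_{t\ge 0}$ of univalent maps $f_t:\mathbb B^n\to\mathbb C^n$ is a normal Loewner chain in $\mathbb B^n$ if $f_s(\mathbb B^n)\subset f_t(\mathbb B^n)$ for all $0\le s\le t$, $f_t(0)=0$ and $d(f_t)_0=e^t\,\mathrm{id}$ for all $t\geq 0$, and the family $\{e^{-t}f_t\}_{t\ge 0}$ is normal in $\mathbb B^n$, that is, every sequence in it has a subsequence converging uniformly on compact subsets of $\mathbb B^n$. Let $S^0(\mathbb B^n)$ be the set of univalent maps $f:\mathbb B^n\to\mathbb C^n$ with $f(0)=0$ and $df_0=\mathrm{id}$ for which there is a normal Loewner chain $(f_t)$ in $\mathbb B^n$ with $f_0=f$. For a holomorphic map $h=(h_1,h_2):\mathbb B^2\to\mathbb C^2$ with $h(0)=0$ and $dh_0$ diagonal and invertible, the shearing of $h$ is $$h^{[c]}(z_1,z_2)=(\lambda z_1+Az_2^2,\ \mu z_2),\qquad \lambda=\frac{\partial h_1}{\partial z_1}(0),\quad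 A=\frac12\frac{\partial^2 h_1}{\partial z_2^2}(0),\quad \mu=\frac{\partial h_2}{\partial z_2}(0).$$ **Theorem.** If $(f_t)_{t\ge0}$ is a normal Loewner chain in $\mathbb B^2$, then $(f_t^{[c]})_{t\ge0}$ is a normal Loewner chain in $\mathbb B^2$. In particular, if $f\in S^0(\mathbb B^2)$, then $f^{[c]}\in S^0(\mathbb B^2)$. -/

import Mathlib

open scoped NNReal

noncomputable section

namespace Shearing

/-- The space `ℂⁿ` with its Hermitian norm. -/
abbrev Cn (n : ℕ) : Type := EuclideanSpace ℂ (Fin n)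

/-- The open unit ball `𝔹ⁿ` of `ℂⁿ`. -/
def unitBall (n : ℕ) : Set (Cn n) := Metric.ball 0 1

/-- Maps `𝔹ⁿ → ℂⁿ` are represented by total functions on `ℂⁿ`, of which only the restriction to
`𝔹ⁿ` matters. Such a map is univalent if it is holomorphic and injective on `𝔹ⁿ`. -/
def IsUnivalent {n : ℕ} (f : Cn n → Cn n) : Prop :=
  DifferentiableOn ℂ f (unitBall n) ∧ Set.InjOn f (unitBall n)

/-- The class `S(𝔹ⁿ)`: univalent maps with `f(0) = 0` and `df₀ = id`. -/
def classS (n : ℕ) : Set (Cn n → Cn n) :=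
  {f | IsUnivalent f ∧ f 0 = 0 ∧ HasFDerivAt f (ContinuousLinearMap.id ℂ (Cn n)) 0}

/-- A normalized Loewner chain on `𝔹ⁿ`. -/
structure IsNormalizedLoewnerChain {n : ℕ} (f : ℝ≥0 → Cn n → Cn n) : Prop where
  univalent : ∀ t, IsUnivalent (f t)
  image_subset : ∀ s t, s ≤ t → f s '' unitBall n ⊆ f t '' unitBall n
  map_zero : ∀ t, f t 0 = 0
  hasFDerivAt_zero : ∀ t : ℝ≥0,
    HasFDerivAt (f t) ((Real.exp (t : ℝ) : ℂ) • ContinuousLinearMap.id ℂ (Cn n)) 0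

/-- A family of maps on `𝔹ⁿ` is normal if every sequence of its members has a subsequence which
converges uniformly on every compact subset of `𝔹ⁿ`. -/
def IsNormalFamily {n : ℕ} {ι : Type*} (F : ι → Cn n → Cn n) : Prop :=
  ∀ u : ℕ → ι, ∃ k : ℕ → ℕ, StrictMono k ∧ ∃ g : Cn n → Cn n,
    ∀ K : Set (Cn n), IsCompact K → K ⊆ unitBall n →
      TendstoUniformlyOn (fun j => F (u (k j))) g Filter.atTop K

/-- A normal Loewner chain on `𝔹ⁿ`: a normalized Loewner chain `(f_t)` such that the family
`{e^{-t} f_t}` is normal in `𝔹ⁿ`. -/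
structure IsNormalLoewnerChain {n : ℕ} (f : ℝ≥0 → Cn n → Cn n) : Prop
    extends IsNormalizedLoewnerChain f where
  normal : IsNormalFamily (fun (t : ℝ≥0) (z : Cn n) => (Real.exp (-(t : ℝ)) : ℂ) • f t z)

/-- The class `S⁰(𝔹ⁿ)` of the maps of `S(𝔹ⁿ)` which admit a parametric representation. -/
def classS0 (n : ℕ) : Set (Cn n → Cn n) :=
  {f | f ∈ classS n ∧
    ∃ F : ℝ≥0 → Cn n → Cn n, IsNormalLoewnerChain F ∧ Set.EqOn (F 0) f (unitBall n)}

/-- `λ = ∂h₁/∂z₁ (0)`, the coefficient of `z₁` in the first component of `h`. -/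
def coeffLam (h : Cn 2 → Cn 2) : ℂ := deriv (fun ζ : ℂ => h !₂[ζ, 0] 0) 0

/-- `μ = ∂h₂/∂z₂ (0)`, the coefficient of `z₂` in the second component of `h`. -/
def coeffMu (h : Cn 2 → Cn 2) : ℂ := deriv (fun ζ : ℂ => h !₂[0, ζ] 1) 0

/-- `A = (1/2) ∂²h₁/∂z₂² (0)`, the coefficient of `z₂²` in the first component of `h`. -/
def coeffA (h : Cn 2 → Cn 2) : ℂ := (1 / 2) * iteratedDeriv 2 (fun ζ : ℂ => h !₂[0, ζ] 0) 0

/-- The shearing `h^{[c]}(z₁, z₂) = (λ z₁ + A z₂², μ z₂)` of `h`. It is meant for `h` holomorphic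
on `𝔹²` with `h(0) = 0` and `dh₀` diagonal and invertible. -/
def shearing (h : Cn 2 → Cn 2) : Cn 2 → Cn 2 :=
  fun z => !₂[coeffLam h * z 0 + coeffA h * z 1 ^ 2, coeffMu h * z 1]

end Shearing

end

/-!
For a normal Loewner chain `(f_t)` and `s ≤ t`, the transition map `φ = f_t⁻¹ ∘ f_s` is a holomorphic
self-map of the ball with `φ(0) = 0` and `dφ₀ = e^{s-t} id`. Comparing Taylor coefficients in
`f_t ∘ φ = f_s` shows that the shearings of the members of the chain satisfy
`f_t^{[c]} ∘ φ^{[c]} = f_s^{[c]}`, so `f_s^{[c]}(𝔹²) ⊆ f_t^{[c]}(𝔹²)` as soon as `φ^{[c]}` maps the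
ball into itself. Now `φ^{[c]}` is the average of `U⁻¹ ∘ φ ∘ U` over the unitary maps
`U(z₁, z₂) = (ζ² z₁, ζ z₂)` with `|ζ| = 1`, since these are the only terms of the Taylor series that
survive; and averages of self-maps of the ball are self-maps of the ball. This is
`shearing_transition_mem`, in which the maximum principle replaces the average. The coefficients are
compared in `tendsto_weighted_coeff`.

That `φ` is holomorphic needs Osgood's theorem, that injective holomorphic maps between domains of
the same dimension are locally biholomorphic. It is proved in dimension two (`jacobian_ne_zero`),
after the holomorphy of the derivatives of a holomorphic map of several variables
(`differentiableOn_fderiv_apply`) and the one-variable case (`deriv_ne_zero_of_injOn`).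

Normality of the new chain is the convergence of the coefficients `A` under locally uniform
convergence (`tendsto_coeffA`).
-/

open Set Filter Topology Metric

namespace Shearing

/-! ### Holomorphic maps of several variables and injective functions of one variable -/

section Holomorphic

variable {E F : Type*} [NormedAddCommGroup E] [NormedSpace ℂ E] [FiniteDimensional ℂ E]
  [NormedAddCommGroup F] [NormedSpace ℂ F] [FiniteDimensional ℂ F]

open MeasureTheory in
/-- Directional derivatives of a holomorphic map of several variables are holomorphic: they are
given by Cauchy's formula on small discs in the direction `v`, and this integral may be
differentiated with respect to the base point. -/
theorem differentiableOn_fderiv_apply {U : Set E} (hU : IsOpen U) {f : E → F}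
    (hf : DifferentiableOn ℂ f U) (v : E) :
    DifferentiableOn ℂ (fun x => fderiv ℂ f x v) U := by
  have := FiniteDimensional.complete ℂ F
  have := FiniteDimensional.proper ℂ (E →L[ℂ] F)
  borelize E
  borelize (E →L[ℂ] F)
  intro x₀ hx₀
  have hfa : ∀ y ∈ U, DifferentiableAt ℂ f y := fun y hy => hf.differentiableAt (hU.mem_nhds hy)
  obtain ⟨ρ, hρ, hρU⟩ : ∃ ρ > 0, ∀ y ∈ ball x₀ ρ, y ∈ U ∧ ‖f y‖ < ‖f x₀‖ + 1 := by
    have h1 : ∀ᶠ y in 𝓝 x₀, y ∈ U ∧ ‖f y‖ < ‖f x₀‖ + 1 :=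
      (hU.eventually_mem hx₀).and
        ((hfa x₀ hx₀).continuousAt.norm.eventually (gt_mem_nhds (lt_add_one _)))
    exact Metric.eventually_nhds_iff_ball.mp h1
  set M := ‖f x₀‖ + 1 with hM
  have hMpos : 0 < M := by positivity
  have hbound : ∀ y ∈ ball x₀ (ρ / 2), ‖fderiv ℂ f y‖ ≤ (2 * M) / (ρ / 2) := by
    intro y hy
    have hsub : ball y (ρ / 2) ⊆ ball x₀ ρ := by
      apply ball_subset_ball'
      have := mem_ball.mp hy
      linarith
    refine Complex.norm_fderiv_le_div_of_mapsTo_ball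
      (hf.mono fun z hz => (hρU z (hsub hz)).1) (fun z hz => ?_) (by positivity)
    have h1 := (hρU z (hsub hz)).2
    have h2 := (hρU y (hsub (mem_ball_self (by positivity)))).2
    rw [mem_closedBall, dist_eq_norm]
    exact (norm_sub_le _ _).trans (by linarith)
  obtain ⟨r, hr, hrv⟩ : ∃ r > 0, r * ‖v‖ < ρ / 4 := by
    refine ⟨ρ / (4 * (‖v‖ + 1)), by positivity, ?_⟩
    rw [div_mul_eq_mul_div, div_lt_div_iff₀ (by positivity) (by positivity)]
    nlinarith [norm_nonneg v]
  have hmem : ∀ x ∈ ball x₀ (ρ / 4), ∀ ζ : ℂ, ‖ζ‖ ≤ r → x + ζ • v ∈ ball x₀ (ρ / 2) := by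
    intro x hx ζ hζ
    rw [mem_ball, dist_eq_norm] at hx ⊢
    calc ‖x + ζ • v - x₀‖ = ‖(x - x₀) + ζ • v‖ := by congr 1; abel
      _ ≤ ‖x - x₀‖ + ‖ζ‖ * ‖v‖ := (norm_add_le _ _).trans (by rw [norm_smul])
      _ ≤ ‖x - x₀‖ + r * ‖v‖ := by gcongr
      _ < ρ / 2 := by linarith
  have hsub2 : ball x₀ (ρ / 2) ⊆ U := fun y hy =>
    (hρU y (ball_subset_ball (by linarith) hy)).1
  have hcirc : ∀ θ : ℝ, ‖circleMap 0 r θ‖ ≤ r := fun θ => by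
    simp [circleMap, abs_of_pos hr]
  have hcauchy : ∀ x ∈ ball x₀ (ρ / 4), fderiv ℂ f x v =
      (2 * Real.pi * Complex.I : ℂ)⁻¹ • ∫ θ in Ioc 0 (2 * Real.pi),
        (deriv (circleMap 0 r) θ * (1 / (circleMap 0 r θ - 0) ^ 2)) •
          f (x + circleMap 0 r θ • v) := by
    intro x hx
    have hd : DifferentiableOn ℂ (fun ζ : ℂ => f (x + ζ • v)) (closedBall 0 r) := by
      intro ζ hζ
      have h1 : DifferentiableAt ℂ f (x + ζ • v) :=
        hfa _ (hsub2 (hmem x hx ζ (by simpa using hζ)))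
      exact (h1.comp ζ (by fun_prop : DifferentiableAt ℂ (fun ζ : ℂ => x + ζ • v) ζ)
        ).differentiableWithinAt
    have h1 := DifferentiableOn.deriv_eq_smul_circleIntegral hr hd
    have h2 : deriv (fun ζ : ℂ => f (x + ζ • v)) 0 = fderiv ℂ f x v := by
      have hx' : DifferentiableAt ℂ f x := by
        have := hfa _ (hsub2 (hmem x hx 0 (by simpa using hr.le)))
        simpa using this
      have := (hx'.hasFDerivAt.hasLineDerivAt v).lineDeriv
      simpa [lineDeriv] using this
    rw [h2, circleIntegral, intervalIntegral.integral_of_le (by positivity)] at h1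
    rw [eq_inv_smul_iff₀ (by simp [Real.pi_ne_zero]), ← h1]
    simp only [smul_smul]
  have hnear : ball x₀ (ρ / 4) ∈ 𝓝 x₀ := ball_mem_nhds _ (by positivity)
  have hcont : ∀ x ∈ ball x₀ (ρ / 4), Continuous (fun θ : ℝ =>
      (deriv (circleMap 0 r) θ * (1 / (circleMap 0 r θ - 0) ^ 2)) •
        f (x + circleMap 0 r θ • v)) := by
    intro x hx
    refine Continuous.smul ?_ ?_
    · simp only [deriv_circleMap]
      refine ((continuous_circleMap 0 r).mul continuous_const).mul
        (continuous_const.div (by fun_prop) fun θ => ?_)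
      simp [hr.ne']
    · rw [continuous_iff_continuousAt]
      intro θ
      exact ContinuousAt.comp (f := fun θ : ℝ => x + circleMap 0 r θ • v)
        (hfa _ (hsub2 (hmem x hx _ (hcirc θ)))).continuousAt (by fun_prop)
  have key : HasFDerivAt (fun x => ∫ θ in Ioc 0 (2 * Real.pi),
        (deriv (circleMap 0 r) θ * (1 / (circleMap 0 r θ - 0) ^ 2)) •
          f (x + circleMap 0 r θ • v))
      (∫ θ in Ioc 0 (2 * Real.pi), (deriv (circleMap 0 r) θ * (1 / (circleMap 0 r θ - 0) ^ 2)) •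
          fderiv ℂ f (x₀ + circleMap 0 r θ • v)) x₀ := by
    refine hasFDerivAt_integral_of_dominated_of_fderiv_le
      (F' := fun x θ => (deriv (circleMap 0 r) θ * (1 / (circleMap 0 r θ - 0) ^ 2)) •
          fderiv ℂ f (x + circleMap 0 r θ • v))
      (bound := fun _ => r * (1 / r ^ 2) * ((2 * M) / (ρ / 2))) hnear ?_ ?_ ?_ ?_ ?_ ?_
    · filter_upwards [hnear] with x hx
      exact (hcont x hx).aestronglyMeasurable
    · exact (hcont x₀ (mem_of_mem_nhds hnear)).integrableOn_Ioc
    · have h1 : Measurable (fun θ : ℝ => fderiv ℂ f (x₀ + circleMap 0 r θ • v)) :=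
        (measurable_fderiv ℂ f).comp (by fun_prop : Continuous _).measurable
      refine AEStronglyMeasurable.smul
        (f := fun θ => deriv (circleMap 0 r) θ * (1 / (circleMap 0 r θ - 0) ^ 2))
        (Continuous.aestronglyMeasurable ?_) h1.aestronglyMeasurable
      simp only [deriv_circleMap]
      refine ((continuous_circleMap 0 r).mul continuous_const).mul
        (continuous_const.div (by fun_prop) fun θ => ?_)
      simp [hr.ne']
    · refine Eventually.of_forall fun θ x hx => ?_
      rw [norm_smul]
      gcongr
      · simp [abs_of_pos hr]
      · exact hbound _ (hmem x hx _ (hcirc θ))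
    · exact integrable_const _
    · refine Eventually.of_forall fun θ x hx => ?_
      have h1 := (hfa _ (hsub2 (hmem x hx _ (hcirc θ)))).hasFDerivAt
      have h2 : HasFDerivAt (fun x => x + circleMap 0 r θ • v) (ContinuousLinearMap.id ℂ E) x :=
        (hasFDerivAt_id x).add_const _
      exact (h1.comp x h2).const_smul
        (deriv (circleMap 0 r) θ * (1 / (circleMap 0 r θ - 0) ^ 2))
  refine ((key.differentiableAt.const_smul
    ((2 * Real.pi * Complex.I : ℂ)⁻¹)).congr_of_eventuallyEq ?_).differentiableWithinAt
  filter_upwards [hnear] with x hx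
  exact hcauchy x hx

/-- A holomorphic map of several variables is strictly differentiable. -/
theorem hasStrictFDerivAt_of_differentiableOn {U : Set E} (hU : IsOpen U) {f : E → F}
    (hf : DifferentiableOn ℂ f U) {x : E} (hx : x ∈ U) :
    HasStrictFDerivAt f (fderiv ℂ f x) x := by
  refine hasStrictFDerivAt_of_hasFDerivAt_of_continuousAt (f' := fderiv ℂ f) ?_ ?_
  · filter_upwards [hU.mem_nhds hx] with y hy
    exact (hf.differentiableAt (hU.mem_nhds hy)).hasFDerivAt
  · refine continuousAt_clm_apply.mpr fun v => ?_
    exact ((differentiableOn_fderiv_apply hU hf v).differentiableAt (hU.mem_nhds hx)).continuousAt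

end Holomorphic

/-- An injective holomorphic function of one variable has nonvanishing derivative: otherwise it is,
up to an additive constant, the `k`-th power of a local coordinate with `k ≥ 2`. -/
theorem deriv_ne_zero_of_injOn {g : ℂ → ℂ} {z₀ : ℂ} {s : Set ℂ} (hs : s ∈ 𝓝 z₀)
    (hg : AnalyticAt ℂ g z₀) (hinj : InjOn g s) : deriv g z₀ ≠ 0 := by
  intro hder
  have hg' : AnalyticAt ℂ (fun z => g z - g z₀) z₀ := hg.sub analyticAt_const
  have hnz : ¬ ∀ᶠ z in 𝓝 z₀, g z - g z₀ = 0 := by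
    intro h
    have h2 : ∀ᶠ z in 𝓝[≠] z₀, False := by
      filter_upwards [(h.and hs).filter_mono nhdsWithin_le_nhds, self_mem_nhdsWithin]
        with z hz hne
      exact hne (hinj hz.2 (mem_of_mem_nhds hs) (sub_eq_zero.mp hz.1))
    simp at h2
    exact (NeBot.ne inferInstance) h2
  obtain ⟨k, u, hu, hu0, hgu⟩ := (hg'.exists_eventuallyEq_pow_smul_nonzero_iff).mpr hnz
  have hk0 : k ≠ 0 := by
    rintro rfl
    have := hgu.self_of_nhds
    simp at this
    exact hu0 this.symm
  have hk1 : k ≠ 1 := by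
    rintro rfl
    have h1 : HasDerivAt (fun z => (z - z₀) ^ 1 • u z) (u z₀) z₀ := by
      have := (((hasDerivAt_id z₀).sub_const z₀).fun_mul hu.differentiableAt.hasDerivAt)
      simpa using this
    have h2 : HasDerivAt (fun z => g z - g z₀) (u z₀) z₀ := h1.congr_of_eventuallyEq hgu
    have h3 : HasDerivAt (fun z => g z - g z₀) 0 z₀ := by
      have := hg.differentiableAt.hasDerivAt.sub_const (g z₀)
      rwa [hder] at this
    exact hu0 (h2.unique h3)
  -- `ψ` is a `k`-th root of `g - g z₀`, and a local coordinate at `z₀`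
  set c : ℂ := (u z₀) ^ ((k : ℂ)⁻¹) with hc
  have hck : c ^ k = u z₀ := Complex.cpow_nat_inv_pow _ hk0
  have hcne : c ≠ 0 := fun h => hu0 (by rw [← hck, h, zero_pow hk0])
  set ψ : ℂ → ℂ := fun z => (z - z₀) * (c * (u z / u z₀) ^ ((k : ℂ)⁻¹)) with hψ
  have hψa : AnalyticAt ℂ (fun z => c * (u z / u z₀) ^ ((k : ℂ)⁻¹)) z₀ := by
    refine analyticAt_const.mul (AnalyticAt.cpow (hu.div analyticAt_const hu0) analyticAt_const ?_)
    simp [hu0]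
  have hψan : AnalyticAt ℂ ψ z₀ := (analyticAt_id.sub analyticAt_const).mul hψa
  have hψd : HasDerivAt ψ c z₀ := by
    have := ((hasDerivAt_id z₀).sub_const z₀).fun_mul hψa.differentiableAt.hasDerivAt
    simpa [hu0] using this
  have hψs : HasStrictDerivAt ψ c z₀ := by
    have := hψan.hasStrictDerivAt
    rwa [hψd.deriv] at this
  have hmap : map ψ (𝓝 z₀) = 𝓝 0 := by
    have := hψs.map_nhds_eq hcne
    simpa [hψ] using this
  have hgψ : ∀ᶠ z in 𝓝 z₀, z ∈ s ∧ g z - g z₀ = ψ z ^ k := by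
    filter_upwards [hs, hgu] with z hz h
    refine ⟨hz, ?_⟩
    rw [h, hψ]
    simp only [smul_eq_mul, mul_pow, Complex.cpow_nat_inv_pow _ hk0, hck]
    field_simp
  have him : ψ '' {z | z ∈ s ∧ g z - g z₀ = ψ z ^ k} ∈ 𝓝 (0 : ℂ) := by
    rw [← hmap]
    exact image_mem_map hgψ
  obtain ⟨ε, hε, hball⟩ := Metric.mem_nhds_iff.mp him
  obtain ⟨ω, hω⟩ : ∃ ω : ℂ, IsPrimitiveRoot ω k := ⟨_, Complex.isPrimitiveRoot_exp k hk0⟩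
  have hωn : ‖ω‖ = 1 := Complex.norm_eq_one_of_pow_eq_one hω.pow_eq_one hk0
  have hn : ‖((ε / 2 : ℝ) : ℂ)‖ = ε / 2 := by
    rw [Complex.norm_real, Real.norm_of_nonneg (by positivity)]
  obtain ⟨z₁, ⟨hz1, hz1'⟩, e1⟩ := hball (show ((ε / 2 : ℝ) : ℂ) ∈ ball 0 ε by
    rw [mem_ball_zero_iff, hn]; linarith)
  obtain ⟨z₂, ⟨hz2, hz2'⟩, e2⟩ := hball (show ω * ((ε / 2 : ℝ) : ℂ) ∈ ball 0 ε by
    rw [mem_ball_zero_iff, norm_mul, hn, hωn]; linarith)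
  have heq : z₁ = z₂ := by
    apply hinj hz1 hz2
    have : g z₁ - g z₀ = g z₂ - g z₀ := by
      rw [hz1', hz2', e1, e2, mul_pow, hω.pow_eq_one, one_mul]
    simpa using this
  have h1 : ω * ((ε / 2 : ℝ) : ℂ) = ((ε / 2 : ℝ) : ℂ) := by rw [← e2, ← heq, e1]
  have h2 : ω = 1 := by
    have h3 : ((ε / 2 : ℝ) : ℂ) ≠ 0 := by exact_mod_cast (by positivity : ε / 2 ≠ 0)
    exact mul_right_cancel₀ h3 (by rw [h1, one_mul])
  exact hω.ne_one (by omega) h2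

/-! ### Level curves and zeros of holomorphic functions -/

section LocalInverse

variable {E F : Type*} [NormedAddCommGroup E] [NormedSpace ℂ E] [FiniteDimensional ℂ E]
  [NormedAddCommGroup F] [NormedSpace ℂ F] [FiniteDimensional ℂ F]

theorem contDiffAt_one_of_differentiableOn {U : Set E} (hU : IsOpen U) {f : E → F}
    (hf : DifferentiableOn ℂ f U) {x : E} (hx : x ∈ U) : ContDiffAt ℂ 1 f x := by
  rw [contDiffAt_one_iff]
  refine ⟨fderiv ℂ f, U, hU.mem_nhds hx, ?_, fun y hy =>
    (hf.differentiableAt (hU.mem_nhds hy)).hasFDerivAt⟩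
  exact continuousOn_clm_apply.mpr fun v => (differentiableOn_fderiv_apply hU hf v).continuousOn

/-- The holomorphic inverse function theorem between spaces of the same dimension. -/
theorem exists_local_inverse {U : Set E} (hU : IsOpen U) {f : E → F}
    (hf : DifferentiableOn ℂ f U) {q : E} (hq : q ∈ U)
    (hdim : Module.finrank ℂ E = Module.finrank ℂ F)
    (hinj : Function.Injective (fderiv ℂ f q)) :
    ∃ g : F → E, g (f q) = q ∧ ContDiffAt ℂ 1 g (f q) ∧ (∀ᶠ x in 𝓝 q, g (f x) = x) ∧
      ∀ᶠ y in 𝓝 (f q), f (g y) = y := by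
  have := FiniteDimensional.complete ℂ E
  let e : E ≃L[ℂ] F := (LinearEquiv.ofInjectiveOfFinrankEq
    (fderiv ℂ f q : E →ₗ[ℂ] F) hinj hdim).toContinuousLinearEquiv
  have he : (e : E →L[ℂ] F) = fderiv ℂ f q := by
    ext x
    rfl
  have hs : HasStrictFDerivAt f (e : E →L[ℂ] F) q := by
    rw [he]
    exact hasStrictFDerivAt_of_differentiableOn hU hf hq
  exact ⟨hs.localInverse f e q, hs.localInverse_apply_image,
    (contDiffAt_one_of_differentiableOn hU hf hq).to_localInverse hs.hasFDerivAt one_ne_zero,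
    hs.eventually_left_inverse, hs.eventually_right_inverse⟩

/-- The level set of a holomorphic function `h` on a complex surface through a point `q` with
`dh_q ≠ 0` is a holomorphic curve near `q`. It is parametrized here by a linear form `ℓ` which is
independent of `dh_q`. -/
theorem exists_level_curve (hE : Module.finrank ℂ E = 2) {U : Set E} (hU : IsOpen U) {h : E → ℂ}
    (hh : DifferentiableOn ℂ h U) {q : E} (hq : q ∈ U) (ℓ : E →L[ℂ] ℂ)
    (hinj : ∀ x, ℓ x = 0 → fderiv ℂ h q x = 0 → x = 0) :
    ∃ c : ℂ → E, c 0 = q ∧ (∀ᶠ w in 𝓝 0, DifferentiableAt ℂ c w) ∧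
      (∀ᶠ w in 𝓝 0, ℓ (c w) = ℓ q + w ∧ h (c w) = h q) ∧
      ∀ᶠ x in 𝓝 q, h x = h q → c (ℓ x - ℓ q) = x := by
  have hd : DifferentiableOn ℂ (fun x => (ℓ x, h x)) U :=
    ℓ.differentiable.differentiableOn.prodMk hh
  have hfd : fderiv ℂ (fun x => (ℓ x, h x)) q = ℓ.prod (fderiv ℂ h q) :=
    (ℓ.hasFDerivAt.prodMk (hh.differentiableAt (hU.mem_nhds hq)).hasFDerivAt).fderiv
  obtain ⟨g, hgq, hg, hl, hr⟩ := exists_local_inverse hU hd hq (by simp [hE]) (by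
    rw [hfd, injective_iff_map_eq_zero]
    intro x hx
    exact hinj x (congrArg Prod.fst hx) (congrArg Prod.snd hx))
  have hι : Tendsto (fun w : ℂ => (ℓ q + w, h q)) (𝓝 0) (𝓝 (ℓ q, h q)) := by
    have : Continuous (fun w : ℂ => (ℓ q + w, h q)) := by fun_prop
    simpa using this.tendsto 0
  refine ⟨fun w => g (ℓ q + w, h q), by simpa using hgq, ?_, ?_, ?_⟩
  · filter_upwards [hι.eventually (hg.eventually (by simp))] with w hw
    exact (hw.differentiableAt one_ne_zero).comp w
      (by fun_prop : DifferentiableAt ℂ (fun w : ℂ => (ℓ q + w, h q)) w)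
  · filter_upwards [hι.eventually hr] with w hw
    exact ⟨congrArg Prod.fst hw, congrArg Prod.snd hw⟩
  · filter_upwards [hl] with x hx hhx
    rw [add_sub_cancel, ← hhx]
    exact hx

/-- In dimension two, the kernel of a nonzero linear form `A` is spanned by any of its nonzero
elements. -/
theorem eq_zero_of_apply_eq_zero (hE : Module.finrank ℂ E = 2) {A ℓ : E →L[ℂ] ℂ} (hA : A ≠ 0)
    {v : E} (hv : A v = 0) (hℓ : ℓ v = 1) {x : E} (hx : ℓ x = 0) (hAx : A x = 0) : x = 0 := by
  have hv0 : v ≠ 0 := by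
    rintro rfl
    simp at hℓ
  have hA' : (A : E →ₗ[ℂ] ℂ) ≠ 0 := fun h => hA (ContinuousLinearMap.coe_injective h)
  have hker : Module.finrank ℂ (LinearMap.ker (A : E →ₗ[ℂ] ℂ)) = 1 := by
    have h1 := LinearMap.finrank_range_add_finrank_ker (A : E →ₗ[ℂ] ℂ)
    rw [LinearMap.range_eq_top.mpr (LinearMap.surjective hA'), finrank_top,
      Module.finrank_self, hE] at h1
    omega
  obtain ⟨t, ht⟩ := (finrank_eq_one_iff_of_nonzero' (⟨v, hv⟩ : LinearMap.ker (A : E →ₗ[ℂ] ℂ))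
    (by simpa [Subtype.ext_iff] using hv0)).mp hker ⟨x, hAx⟩
  have ht' : t • v = x := congrArg Subtype.val ht
  rw [← ht', map_smul, hℓ, smul_eq_mul, mul_one] at hx
  rw [← ht', hx, zero_smul]

end LocalInverse

section Zeros

variable {E : Type*} [NormedAddCommGroup E] [NormedSpace ℂ E]

/-- The zeros of a holomorphic function on the lines parallel to `v` persist: if `q` is an isolated
zero of `J` on the line `q + ℂ v`, then `J` has zeros near `q` on all nearby parallel lines. -/
theorem eventually_exists_zero {U : Set E} (hU : IsOpen U) {J : E → ℂ}
    (hJ : DifferentiableOn ℂ J U) {q v : E} (hq : q ∈ U) (hJq : J q = 0)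
    (hnz : ¬ ∀ᶠ w : ℂ in 𝓝 0, J (q + w • v) = 0) {N : Set E} (hN : N ∈ 𝓝 q) :
    ∀ᶠ x in 𝓝 q, ∃ w : ℂ, x + w • v ∈ N ∧ J (x + w • v) = 0 := by
  have hline : Continuous (fun w : ℂ => q + w • v) := by fun_prop
  have hpair : Continuous (fun z : E × ℂ => z.1 + z.2 • v) := by fun_prop
  have hNU : N ∩ U ∈ 𝓝 q := inter_mem hN (hU.mem_nhds hq)
  obtain ⟨W, hWsub, hWo, hqW⟩ := _root_.mem_nhds_iff.mp hNU
  have hdiff : ∀ x : E, ∀ w : ℂ, x + w • v ∈ W →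
      DifferentiableAt ℂ (fun w : ℂ => J (x + w • v)) w := fun x w hw =>
    (hJ.differentiableAt (hU.mem_nhds (hWsub hw).2)).comp w
      (by fun_prop : DifferentiableAt ℂ (fun w : ℂ => x + w • v) w)
  have hW0 : ∀ᶠ w : ℂ in 𝓝 0, q + w • v ∈ W :=
    hline.continuousAt.eventually_mem (by simpa using hWo.mem_nhds hqW)
  have han : AnalyticAt ℂ (fun w : ℂ => J (q + w • v)) 0 := by
    obtain ⟨s, hs, hso, h0s⟩ := _root_.eventually_nhds_iff.mp hW0
    exact DifferentiableOn.analyticAt (s := s)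
      (fun w hw => (hdiff q w (hs w hw)).differentiableWithinAt) (hso.mem_nhds h0s)
  have hne := han.eventually_eq_zero_or_eventually_ne_zero.resolve_left hnz
  rw [eventually_nhdsWithin_iff] at hne
  obtain ⟨R, hR, hball⟩ := Metric.eventually_nhds_iff_ball.mp (hne.and hW0)
  set r := R / 2 with hr
  have hrpos : 0 < r := by positivity
  have hsub : ∀ w : ℂ, ‖w‖ ≤ r → w ∈ ball (0 : ℂ) R := fun w hw => by
    rw [mem_ball_zero_iff]; linarith
  obtain ⟨w₀, hw₀, hmin⟩ := (isCompact_sphere (0 : ℂ) r).exists_isMinOn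
    (NormedSpace.sphere_nonempty.mpr hrpos.le)
    (f := fun w => ‖J (q + w • v)‖) (fun w hw => by
      have : ‖w‖ ≤ r := (mem_sphere_zero_iff_norm.mp hw).le
      exact (hdiff q w (hball w (hsub w this)).2).continuousAt.norm.continuousWithinAt)
  set δ := ‖J (q + w₀ • v)‖ with hδ
  have hδpos : 0 < δ := by
    have h1 : ‖w₀‖ = r := mem_sphere_zero_iff_norm.mp hw₀
    refine norm_pos_iff.mpr ((hball w₀ (hsub w₀ h1.le)).1 ?_)
    rintro rfl
    simp at h1
    linarith
  have hev1 : ∀ᶠ x in 𝓝 q, ∀ w ∈ closedBall (0 : ℂ) r, x + w • v ∈ W := by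
    refine (isCompact_closedBall (0 : ℂ) r).eventually_forall_of_forall_eventually
      (P := fun x w => x + w • v ∈ W) fun w hw => ?_
    exact hpair.continuousAt.eventually_mem
      (hWo.mem_nhds (hball w (hsub w (mem_closedBall_zero_iff.mp hw))).2)
  have hev2 : ∀ᶠ x in 𝓝 q, ∀ w ∈ sphere (0 : ℂ) r, δ / 2 < ‖J (x + w • v)‖ := by
    refine (isCompact_sphere (0 : ℂ) r).eventually_forall_of_forall_eventually
      (P := fun x w => δ / 2 < ‖J (x + w • v)‖) fun w hw => ?_
    have h1 : ‖w‖ ≤ r := (mem_sphere_zero_iff_norm.mp hw).le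
    have h2 : ContinuousAt (fun z : E × ℂ => J (z.1 + z.2 • v)) (q, w) :=
      ContinuousAt.comp (f := fun z : E × ℂ => z.1 + z.2 • v)
        (hJ.differentiableAt
          (hU.mem_nhds (hWsub (hball w (hsub w h1)).2).2)).continuousAt hpair.continuousAt
    refine h2.norm.eventually (lt_mem_nhds ?_)
    have : δ ≤ ‖J (q + w • v)‖ := hmin hw
    change δ / 2 < ‖J (q + w • v)‖
    linarith
  have hev3 : ∀ᶠ x in 𝓝 q, ‖J x‖ < δ / 2 := by
    refine (hJ.differentiableAt (hU.mem_nhds hq)).continuousAt.norm.eventually (gt_mem_nhds ?_)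
    simpa only [hJq, norm_zero] using half_pos hδpos
  filter_upwards [hev1, hev2, hev3] with x h1 h2 h3
  by_contra! hcon
  have hnz' : ∀ w ∈ closedBall (0 : ℂ) r, J (x + w • v) ≠ 0 := fun w hw =>
    hcon w (hWsub (h1 w hw)).1
  -- the maximum principle for `1 / J` on the disc of radius `r`
  have hdc : DifferentiableOn ℂ (fun w : ℂ => (J (x + w • v))⁻¹) (closedBall 0 r) := fun w hw =>
    ((hdiff x w (h1 w hw)).inv (hnz' w hw)).differentiableWithinAt
  have hmax := Complex.norm_le_of_forall_mem_frontier_norm_le (isBounded_ball (x := (0 : ℂ)))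
    (hdc.diffContOnCl_ball subset_rfl) (C := (δ / 2)⁻¹) (fun w hw => by
      rw [frontier_ball _ hrpos.ne'] at hw
      rw [norm_inv]
      exact inv_anti₀ (by positivity) (h2 w hw).le)
    (subset_closure (mem_ball_self hrpos))
  simp only [zero_smul, add_zero, norm_inv] at hmax
  have h4 : 0 < ‖J x‖ := by
    have := hnz' 0 (mem_closedBall_self hrpos.le)
    simpa using this
  rw [inv_le_inv₀ h4 (by positivity)] at hmax
  linarith

/-- The iterated derivative in the direction `v`. -/
noncomputable def iterDirDeriv (v : E) (k : ℕ) (J : E → ℂ) : E → ℂ :=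
  (fun (h : E → ℂ) (x : E) => fderiv ℂ h x v)^[k] J

theorem iterDirDeriv_succ (v : E) (k : ℕ) (J : E → ℂ) (x : E) :
    iterDirDeriv v (k + 1) J x = fderiv ℂ (iterDirDeriv v k J) x v := by
  simp only [iterDirDeriv, Function.iterate_succ_apply']

variable [FiniteDimensional ℂ E]

theorem differentiableOn_iterDirDeriv {U : Set E} (hU : IsOpen U) {J : E → ℂ}
    (hJ : DifferentiableOn ℂ J U) (v : E) (k : ℕ) :
    DifferentiableOn ℂ (iterDirDeriv v k J) U := by
  induction k with
  | zero => exact hJ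
  | succ k ih =>
    exact (differentiableOn_fderiv_apply hU ih v).congr fun x _ => iterDirDeriv_succ v k J x

theorem iteratedDeriv_line {U : Set E} (hU : IsOpen U) {J : E → ℂ}
    (hJ : DifferentiableOn ℂ J U) (p v : E) (k : ℕ) {w : ℂ} (hw : p + w • v ∈ U) :
    iteratedDeriv k (fun w : ℂ => J (p + w • v)) w = iterDirDeriv v k J (p + w • v) := by
  induction k generalizing w with
  | zero => simp [iterDirDeriv]
  | succ k ih =>
    have hline : Continuous (fun w : ℂ => p + w • v) := by fun_prop
    have hev : iteratedDeriv k (fun w : ℂ => J (p + w • v)) =ᶠ[𝓝 w]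
        fun w => iterDirDeriv v k J (p + w • v) := by
      filter_upwards [hline.continuousAt.eventually_mem (hU.mem_nhds hw)] with w' hw'
      exact ih hw'
    rw [iteratedDeriv_succ, hev.deriv_eq, iterDirDeriv_succ]
    have h1 : HasDerivAt (fun w : ℂ => p + w • v) v w := by
      simpa using ((hasDerivAt_id w).smul_const v).const_add p
    exact (((differentiableOn_iterDirDeriv hU hJ v k).differentiableAt
      (hU.mem_nhds hw)).hasFDerivAt.comp_hasDerivAt w h1).deriv

/-- If all derivatives of `J` at `p` in the direction `v` vanish, then `J` vanishes on the line
through `p` in this direction. -/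
theorem eq_zero_of_iterDirDeriv_eq_zero {U : Set E} (hU : IsOpen U) (hUc : Convex ℝ U) {J : E → ℂ}
    (hJ : DifferentiableOn ℂ J U) {p v : E} (hp : p ∈ U)
    (hz : ∀ k, iterDirDeriv v k J p = 0) {w : ℂ} (hw : p + w • v ∈ U) : J (p + w • v) = 0 := by
  have hline : Continuous (fun w : ℂ => p + w • v) := by fun_prop
  have hd : DifferentiableOn ℂ (fun w : ℂ => J (p + w • v)) ((fun w : ℂ => p + w • v) ⁻¹' U) :=
    fun w hw => ((hJ.differentiableAt (hU.mem_nhds hw)).comp w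
      (by fun_prop : DifferentiableAt ℂ (fun w : ℂ => p + w • v) w)).differentiableWithinAt
  have hVo := hU.preimage hline
  have hVc : Convex ℝ ((fun w : ℂ => p + w • v) ⁻¹' U) := by
    intro w₁ h₁ w₂ h₂ a b ha hb hab
    have h3 := hUc h₁ h₂ ha hb hab
    have h4 : a • (p + w₁ • v) + b • (p + w₂ • v) = p + (a • w₁ + b • w₂) • v := by
      have : p = (a + b) • p := by rw [hab, one_smul]
      nth_rewrite 3 [this]
      simp only [smul_add, add_smul, smul_assoc]
      abel
    rw [mem_preimage, ← h4]
    exact h3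
  have h0 : (0 : ℂ) ∈ (fun w : ℂ => p + w • v) ⁻¹' U := by simpa using hp
  refine (hd.analyticOnNhd hVo).eqOn_zero_of_preconnected_of_eventuallyEq_zero
    hVc.isPreconnected h0 ?_ hw
  obtain ⟨R, hR, hball⟩ := Metric.isOpen_iff.mp hVo 0 h0
  filter_upwards [ball_mem_nhds (0 : ℂ) hR] with z hz'
  have h1 := Complex.hasSum_taylorSeries_on_ball (hd.mono hball) hz'
  have h2 : ∀ n, iteratedDeriv n (fun w : ℂ => J (p + w • v)) 0 = 0 := fun n => by
    rw [iteratedDeriv_line hU hJ p v n h0]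
    simpa using hz n
  simp only [h2, smul_zero] at h1
  exact h1.unique hasSum_zero

end Zeros

/-! ### Osgood's theorem in dimension two -/

/-- The complex Jacobian determinant of a map `ℂ² → ℂ²`. -/
noncomputable def jacobian (f : Cn 2 → Cn 2) (x : Cn 2) : ℂ :=
  (Matrix.of fun i j : Fin 2 => fderiv ℂ f x (EuclideanSpace.single j 1) i).det

theorem differentiableOn_jacobian {U : Set (Cn 2)} (hU : IsOpen U) {f : Cn 2 → Cn 2}
    (hf : DifferentiableOn ℂ f U) : DifferentiableOn ℂ (jacobian f) U := by
  have h1 : ∀ i j : Fin 2, DifferentiableOn ℂ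
      (fun x => fderiv ℂ f x (EuclideanSpace.single j 1) i) U := fun i j =>
    (EuclideanSpace.proj (𝕜 := ℂ) i).differentiable.comp_differentiableOn
      (differentiableOn_fderiv_apply hU hf _)
  unfold jacobian
  simp only [Matrix.det_fin_two, Matrix.of_apply]
  exact ((h1 0 0).mul (h1 1 1)).sub ((h1 0 1).mul (h1 1 0))

theorem jacobian_eq_zero_iff {f : Cn 2 → Cn 2} {x : Cn 2} :
    jacobian f x = 0 ↔ ∃ v, v ≠ 0 ∧ fderiv ℂ f x v = 0 := by
  have key : ∀ v : Fin 2 → ℂ,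
      (Matrix.of fun i j : Fin 2 => fderiv ℂ f x (EuclideanSpace.single j 1) i).mulVec v =
        fderiv ℂ f x (WithLp.toLp 2 v) := by
    intro v
    have hv : WithLp.toLp 2 v = v 0 • EuclideanSpace.single (0 : Fin 2) (1 : ℂ) +
        v 1 • EuclideanSpace.single (1 : Fin 2) (1 : ℂ) := by
      ext i
      fin_cases i <;> simp
    ext i
    rw [hv, map_add, map_smul, map_smul]
    simp [Matrix.mulVec, dotProduct, mul_comm]
  rw [jacobian, ← Matrix.exists_mulVec_eq_zero_iff]
  constructor
  · rintro ⟨v, hv, h⟩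
    refine ⟨WithLp.toLp 2 v, by simpa using hv, ?_⟩
    ext i
    have := congrFun (key v) i
    rw [h] at this
    simpa using this.symm
  · rintro ⟨v, hv, h⟩
    refine ⟨v.ofLp, by simpa using hv, ?_⟩
    rw [key, WithLp.toLp_ofLp, h]
    rfl

/-- The differential of an injective holomorphic map `f` on a surface cannot have rank one. If `v`
spanned the kernel of the differential at `x` and `f i` had nonzero differential, then the other
component of `f` would be injective on the level curve of `f i` through `x`, which is tangent to
`v`; so its derivative along this curve would not vanish. -/
theorem fderiv_eq_zero_of_apply_eq_zero {U : Set (Cn 2)} (hU : IsOpen U) {f : Cn 2 → Cn 2}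
    (hf : DifferentiableOn ℂ f U) (hinj : InjOn f U) {x : Cn 2} (hx : x ∈ U) {v : Cn 2}
    (hv : v ≠ 0) (hfv : fderiv ℂ f x v = 0) : fderiv ℂ f x = 0 := by
  by_contra hne
  have hE : Module.finrank ℂ (Cn 2) = 2 := by simp
  obtain ⟨u, i, hui⟩ : ∃ u i, fderiv ℂ f x u i ≠ 0 := by
    by_contra! hcon
    exact hne (by ext u i; simpa using hcon u i)
  have hfx := (hf.differentiableAt (hU.mem_nhds hx)).hasFDerivAt
  have hcomp : ∀ k : Fin 2, HasFDerivAt (fun y => f y k)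
      ((EuclideanSpace.proj (𝕜 := ℂ) k).comp (fderiv ℂ f x)) x := fun k =>
    (EuclideanSpace.proj (𝕜 := ℂ) k).hasFDerivAt.comp x hfx
  have hdi : DifferentiableOn ℂ (fun y => f y i) U :=
    (EuclideanSpace.proj (𝕜 := ℂ) i).differentiable.comp_differentiableOn hf
  obtain ⟨ℓ, hℓ⟩ := SeparatingDual.exists_eq_one (R := ℂ) hv
  have hA : fderiv ℂ (fun y => f y i) x ≠ 0 := by
    rw [(hcomp i).fderiv]
    intro h
    exact hui (by simpa using DFunLike.congr_fun h u)
  have hAv : fderiv ℂ (fun y => f y i) x v = 0 := by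
    rw [(hcomp i).fderiv]
    simp [hfv]
  have hindep := fun y h1 h2 => eq_zero_of_apply_eq_zero hE hA hAv hℓ (x := y) h1 h2
  obtain ⟨c, hc0, hcd, hcl, -⟩ := exists_level_curve hE hU hdi hx ℓ hindep
  have hcd0 : HasDerivAt c (deriv c 0) 0 := hcd.self_of_nhds.hasDerivAt
  have hc' : deriv c 0 = v := by
    have h1 : HasDerivAt (fun w => ℓ (c w)) (ℓ (deriv c 0)) 0 :=
      ℓ.hasFDerivAt.comp_hasDerivAt 0 hcd0
    have h1' : HasDerivAt (fun w => ℓ (c w)) 1 0 :=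
      ((hasDerivAt_id (0 : ℂ)).const_add (ℓ x)).congr_of_eventuallyEq
        (hcl.mono fun w hw => hw.1)
    have h2 : HasDerivAt (fun w => f (c w) i) (fderiv ℂ (fun y => f y i) x (deriv c 0)) 0 := by
      refine HasFDerivAt.comp_hasDerivAt (l := fun y => f y i) 0 ?_ hcd0
      rw [hc0]
      exact (hdi.differentiableAt (hU.mem_nhds hx)).hasFDerivAt
    have h2' : HasDerivAt (fun w => f (c w) i) 0 0 :=
      (hasDerivAt_const (0 : ℂ) (f x i)).congr_of_eventuallyEq (hcl.mono fun w hw => hw.2)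
    have := hindep (deriv c 0 - v) (by rw [map_sub, h1.unique h1', hℓ, sub_self])
      (by rw [map_sub, h2.unique h2', hAv, sub_self])
    exact sub_eq_zero.mp this
  have hcU : ∀ᶠ w in 𝓝 0, c w ∈ U :=
    hcd0.continuousAt.eventually_mem (by rw [hc0]; exact hU.mem_nhds hx)
  have hgood := hcU.and (hcd.and hcl)
  -- `1 - i` is the other index
  have hg : AnalyticAt ℂ (fun w => f (c w) (1 - i)) 0 := by
    obtain ⟨s, hs, hso, h0s⟩ := _root_.eventually_nhds_iff.mp hgood
    refine DifferentiableOn.analyticAt (s := s) (fun w hw => ?_) (hso.mem_nhds h0s)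
    have h1 := (hf.differentiableAt (hU.mem_nhds (hs w hw).1)).comp w (hs w hw).2.1
    exact ((EuclideanSpace.proj (𝕜 := ℂ) (1 - i)).differentiableAt.comp w
      h1).differentiableWithinAt
  refine deriv_ne_zero_of_injOn hgood hg ?_ ?_
  · rintro w₁ ⟨h1, -, h1l, h1h⟩ w₂ ⟨h2, -, h2l, h2h⟩ heq
    have hff : f (c w₁) = f (c w₂) := by
      ext k
      have hk : ∀ i k : Fin 2, k = i ∨ k = 1 - i := by decide
      rcases hk i k with rfl | rfl
      · exact h1h.trans h2h.symm
      · exact heq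
    rw [hinj h1 h2 hff, h2l] at h1l
    exact (add_left_cancel h1l).symm
  · have h2 : HasDerivAt (fun w => f (c w) (1 - i)) (fderiv ℂ f x (deriv c 0) (1 - i)) 0 := by
      refine HasFDerivAt.comp_hasDerivAt (l := fun y => f y (1 - i)) 0
        (l' := (EuclideanSpace.proj (𝕜 := ℂ) (1 - i)).comp (fderiv ℂ f x)) ?_ hcd0
      rw [hc0]
      exact hcomp (1 - i)
    rw [h2.deriv, hc', hfv]
    rfl

/-- **Osgood's theorem** in dimension two: the Jacobian determinant of an injective holomorphic map
has no zeros, provided it does not vanish identically.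

At a zero of the Jacobian determinant the whole differential vanishes. Among the zeros, one chooses
a point `q` where the order of vanishing in a fixed direction `v` is minimal. The derivative of one
order less then defines a smooth curve through `q`; by minimality it contains all zeros near `q`,
and conversely, since zeros persist, it consists of zeros. So `f` is constant on this curve. -/
theorem jacobian_ne_zero {U : Set (Cn 2)} (hU : IsOpen U) (hUc : Convex ℝ U) {f : Cn 2 → Cn 2}
    (hf : DifferentiableOn ℂ f U) (hinj : InjOn f U) {x₀ : Cn 2} (hx₀ : x₀ ∈ U)
    (hJ₀ : jacobian f x₀ ≠ 0) {p : Cn 2} (hp : p ∈ U) : jacobian f p ≠ 0 := by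
  intro hJp
  have hE : Module.finrank ℂ (Cn 2) = 2 := by simp
  have hJ := differentiableOn_jacobian hU hf
  have hdf : ∀ x ∈ U, jacobian f x = 0 → fderiv ℂ f x = 0 := by
    intro x hx hJx
    obtain ⟨v, hv, hfv⟩ := jacobian_eq_zero_iff.mp hJx
    exact fderiv_eq_zero_of_apply_eq_zero hU hf hinj hx hv hfv
  set v := x₀ - p with hv
  have hex : ∃ m, ∃ q ∈ U, jacobian f q = 0 ∧ iterDirDeriv v m (jacobian f) q ≠ 0 := by
    by_contra! hcon
    refine hJ₀ ?_
    have := eq_zero_of_iterDirDeriv_eq_zero hU hUc hJ (v := v) hp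
      (fun k => hcon k p hp hJp) (w := 1) (by simpa [hv] using hx₀)
    simpa [hv] using this
  classical
  -- the minimal order of vanishing is `k + 1`
  obtain ⟨q, hq, hJq, hmq⟩ := Nat.find_spec hex
  have hmin := fun k (hk : k < Nat.find hex) => Nat.find_min hex hk
  obtain ⟨k, hk⟩ : ∃ k, Nat.find hex = k + 1 := by
    refine Nat.exists_eq_succ_of_ne_zero fun h0 => ?_
    rw [h0] at hmq
    exact hmq hJq
  rw [hk] at hmq hmin
  set h := iterDirDeriv v k (jacobian f) with hh
  have hZ : ∀ x ∈ U, jacobian f x = 0 → h x = 0 := by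
    intro x hx hJx
    have := hmin k (Nat.lt_succ_self k)
    push Not at this
    exact this x hx hJx
  have hhd : DifferentiableOn ℂ h U := differentiableOn_iterDirDeriv hU hJ v k
  have hhv : fderiv ℂ h q v ≠ 0 := by
    rwa [iterDirDeriv_succ] at hmq
  have hnz : ¬ ∀ᶠ w : ℂ in 𝓝 0, jacobian f (q + w • v) = 0 := by
    intro hz
    have h1 : iteratedDeriv (k + 1) (fun w : ℂ => jacobian f (q + w • v)) 0 =
        iteratedDeriv (k + 1) (fun _ : ℂ => (0 : ℂ)) 0 :=
      Filter.EventuallyEq.iteratedDeriv_eq _ hz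
    rw [iteratedDeriv_line hU hJ q v (k + 1) (w := 0) (by simpa using hq)] at h1
    refine hmq ?_
    simpa [iteratedDeriv_const] using h1
  -- a linear form `ℓ` which is independent of `dh_q` and vanishes at `v`
  obtain ⟨ℓ, hℓv, hindep⟩ : ∃ ℓ : Cn 2 →L[ℂ] ℂ, ℓ v = 0 ∧
      ∀ x, ℓ x = 0 → fderiv ℂ h q x = 0 → x = 0 := by
    set A := fderiv ℂ h q with hA
    have hA0 : A ≠ 0 := fun h0 => hhv (by rw [h0]; rfl)
    obtain ⟨u, hu, hAu⟩ : ∃ u, u ≠ 0 ∧ A u = 0 := by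
      have h1 : ¬ Function.Injective (A : Cn 2 →ₗ[ℂ] ℂ) := fun hi => by
        have := LinearMap.finrank_le_finrank_of_injective hi
        rw [hE, Module.finrank_self] at this
        omega
      rw [injective_iff_map_eq_zero] at h1
      push Not at h1
      obtain ⟨u, h2, h3⟩ := h1
      exact ⟨u, h3, h2⟩
    obtain ⟨ℓ₁, hℓ₁⟩ := SeparatingDual.exists_eq_one (R := ℂ) hu
    refine ⟨ℓ₁ - (ℓ₁ v / A v) • A, by simp [hhv], fun x hx hAx => ?_⟩
    refine eq_zero_of_apply_eq_zero hE hA0 hAu hℓ₁ ?_ hAx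
    simpa [hAx] using hx
  obtain ⟨c, hc0, hcd, hcl, hcu⟩ := exists_level_curve hE hU hhd hq ℓ hindep
  have hcc : Tendsto c (𝓝 0) (𝓝 q) := by
    have := hcd.self_of_nhds.continuousAt.tendsto
    rwa [hc0] at this
  have hhq : h q = 0 := hZ q hq hJq
  have hcZ : ∀ᶠ z in 𝓝 0, c z ∈ U ∧ jacobian f (c z) = 0 := by
    have hN := hcu.and (hU.eventually_mem hq)
    filter_upwards [hcc.eventually (eventually_exists_zero hU hJ hq hJq hnz hN), hcl]
      with z hz hzl
    obtain ⟨w, ⟨hyc, hyU⟩, hJy⟩ := hz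
    have h1 := hyc ((hZ _ hyU hJy).trans hhq.symm)
    rw [map_add, map_smul, hℓv, smul_zero, add_zero, hzl.1, add_sub_cancel_left] at h1
    rw [← h1] at hyU hJy
    exact ⟨hyU, hJy⟩
  have hgood := hcZ.and (hcd.and hcl)
  obtain ⟨R, hR, hball⟩ := Metric.eventually_nhds_iff_ball.mp hgood
  have hder : ∀ z ∈ ball (0 : ℂ) R, HasDerivAt (fun z => f (c z)) 0 z := by
    intro z hz
    obtain ⟨⟨h1, h2⟩, h3, -⟩ := hball z hz
    have h4 := (hf.differentiableAt (hU.mem_nhds h1)).hasFDerivAt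
    rw [hdf _ h1 h2] at h4
    exact h4.comp_hasDerivAt z h3.hasDerivAt
  have hz1 : ((R / 2 : ℝ) : ℂ) ∈ ball (0 : ℂ) R := by
    rw [mem_ball_zero_iff, Complex.norm_real, Real.norm_of_nonneg (by positivity)]
    linarith
  have hz0 : (0 : ℂ) ∈ ball (0 : ℂ) R := mem_ball_self hR
  have hfc : f (c ((R / 2 : ℝ) : ℂ)) = f (c 0) :=
    isOpen_ball.is_const_of_deriv_eq_zero (convex_ball (0 : ℂ) R).isPreconnected
      (f := fun z => f (c z)) (fun z hz => (hder z hz).differentiableAt.differentiableWithinAt)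
      (fun z hz => (hder z hz).deriv) hz1 hz0
  have hceq := hinj (hball _ hz1).1.1 (hball _ hz0).1.1 hfc
  have h5 := (hball _ hz1).2.2.1
  rw [hceq, (hball _ hz0).2.2.1] at h5
  have h6 := add_left_cancel h5
  have h7 : R / 2 = 0 := by exact_mod_cast h6.symm
  linarith

/-! ### Transition maps of a Loewner chain -/

theorem isOpen_unitBall (n : ℕ) : IsOpen (unitBall n) := isOpen_ball

theorem zero_mem_unitBall (n : ℕ) : (0 : Cn n) ∈ unitBall n := mem_ball_self one_pos

theorem mem_unitBall_two {z : Cn 2} : z ∈ unitBall 2 ↔ ‖z 0‖ ^ 2 + ‖z 1‖ ^ 2 < 1 := by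
  rw [unitBall, mem_ball_zero_iff, ← sq_lt_one_iff₀ (norm_nonneg z), EuclideanSpace.norm_sq_eq,
    Fin.sum_univ_two]

theorem hasFDerivAt_euclidean {E : Type*} [NormedAddCommGroup E] [NormedSpace ℂ E] {n : ℕ}
    {f : E → Cn n} {f' : E →L[ℂ] Cn n} {x : E} :
    HasFDerivAt f f' x ↔
      ∀ i, HasFDerivAt (fun y => f y i) ((EuclideanSpace.proj i : Cn n →L[ℂ] ℂ).comp f') x := by
  simp only [← hasFDerivWithinAt_univ]
  exact hasFDerivWithinAt_euclidean

theorem hasDerivAt_euclidean {n : ℕ} {f : ℂ → Cn n} {v : Cn n} {ζ : ℂ} :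
    HasDerivAt f v ζ ↔ ∀ i, HasDerivAt (fun ξ => f ξ i) (v i) ζ := by
  simp only [hasDerivAt_iff_hasFDerivAt]
  rw [hasFDerivAt_euclidean]
  refine forall_congr' fun i => ?_
  have : (EuclideanSpace.proj i : Cn n →L[ℂ] ℂ).comp (ContinuousLinearMap.toSpanSingleton ℂ v) =
      ContinuousLinearMap.toSpanSingleton ℂ (v i) := by
    ext
    simp
  rw [← this]

/-- If `c • id` and `c' • id`, with `c' ≠ 0`, are the differentials at `0` of univalent maps `f`
and `g` with `f(𝔹²) ⊆ g(𝔹²)`, then `φ = g⁻¹ ∘ f` is a holomorphic self-map of the ball. -/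
theorem exists_transition {f g : Cn 2 → Cn 2} (hf : IsUnivalent f) (hg : IsUnivalent g)
    (hf0 : f 0 = 0) (hg0 : g 0 = 0) {c c' : ℂ} (hc' : c' ≠ 0)
    (hfd : HasFDerivAt f (c • ContinuousLinearMap.id ℂ (Cn 2)) 0)
    (hgd : HasFDerivAt g (c' • ContinuousLinearMap.id ℂ (Cn 2)) 0)
    (hsub : f '' unitBall 2 ⊆ g '' unitBall 2) :
    ∃ φ : Cn 2 → Cn 2, MapsTo φ (unitBall 2) (unitBall 2) ∧ DifferentiableOn ℂ φ (unitBall 2) ∧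
      (∀ z ∈ unitBall 2, g (φ z) = f z) ∧ φ 0 = 0 ∧
      HasFDerivAt φ ((c / c') • ContinuousLinearMap.id ℂ (Cn 2)) 0 := by
  have hO := isOpen_unitBall 2
  have hex : ∀ z, ∃ w, z ∈ unitBall 2 → w ∈ unitBall 2 ∧ g w = f z := by
    intro z
    by_cases hz : z ∈ unitBall 2
    · obtain ⟨w, hw, h⟩ := hsub (mem_image_of_mem f hz)
      exact ⟨w, fun _ => ⟨hw, h⟩⟩
    · exact ⟨0, fun h => absurd h hz⟩
  choose φ hφ using hex
  have hJ0 : jacobian g 0 ≠ 0 := by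
    intro h
    obtain ⟨v, hv, h0⟩ := jacobian_eq_zero_iff.mp h
    rw [hgd.fderiv] at h0
    exact hv ((smul_eq_zero.mp (by simpa using h0)).resolve_left hc')
  have hφd : DifferentiableOn ℂ φ (unitBall 2) := by
    intro z hz
    obtain ⟨hw, hgw⟩ := hφ z hz
    have hJ := jacobian_ne_zero hO (convex_ball 0 1) hg.1 hg.2 (zero_mem_unitBall 2) hJ0 hw
    have hinj : Function.Injective (fderiv ℂ g (φ z)) := by
      rw [injective_iff_map_eq_zero]
      intro v hv
      by_contra hne
      exact hJ (jacobian_eq_zero_iff.mpr ⟨v, hne, hv⟩)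
    obtain ⟨G, hG0, hG, -, hGr⟩ := exists_local_inverse hO hg.1 hw rfl hinj
    have hfz : DifferentiableAt ℂ f z := hf.1.differentiableAt (hO.mem_nhds hz)
    rw [hgw] at hG0 hG hGr
    have hGc : ContinuousAt G (f z) := hG.continuousAt
    have hev : φ =ᶠ[𝓝 z] fun z => G (f z) := by
      have h1 : ∀ᶠ y in 𝓝 (f z), G y ∈ unitBall 2 :=
        hGc.eventually_mem (by rw [hG0]; exact hO.mem_nhds hw)
      filter_upwards [hO.eventually_mem hz, hfz.continuousAt.eventually (h1.and hGr)]
        with y hy hy2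
      exact hg.2 (hφ y hy).1 hy2.1 ((hφ y hy).2.trans hy2.2.symm)
    exact (((hG.differentiableAt one_ne_zero).comp z hfz).congr_of_eventuallyEq
      hev).differentiableWithinAt
  have h0 := zero_mem_unitBall 2
  have hφ0 : φ 0 = 0 := hg.2 (hφ 0 h0).1 h0 (by rw [(hφ 0 h0).2, hf0, hg0])
  refine ⟨φ, fun z hz => (hφ z hz).1, hφd, fun z hz => (hφ z hz).2, hφ0, ?_⟩
  have hd := (hφd.differentiableAt (hO.mem_nhds h0)).hasFDerivAt
  have h1 : HasFDerivAt (fun z => g (φ z))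
      ((c' • ContinuousLinearMap.id ℂ (Cn 2)).comp (fderiv ℂ φ 0)) 0 := by
    refine HasFDerivAt.comp (g := g) 0 ?_ hd
    rwa [hφ0]
  have h2 : HasFDerivAt (fun z => g (φ z)) (c • ContinuousLinearMap.id ℂ (Cn 2)) 0 :=
    hfd.congr_of_eventuallyEq (by
      filter_upwards [hO.eventually_mem h0] with z hz
      exact (hφ z hz).2)
  have h3 := h1.unique h2
  have h4 : fderiv ℂ φ 0 = (c / c') • ContinuousLinearMap.id ℂ (Cn 2) := by
    ext1 v
    have h5 : c' • fderiv ℂ φ 0 v = c • v := by simpa using DFunLike.congr_fun h3 v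
    simp only [_root_.smul_apply, ContinuousLinearMap.id_apply]
    rw [div_eq_inv_mul, mul_smul, ← h5, inv_smul_smul₀ hc']
  rwa [h4] at hd

/-- The second-order Taylor coefficient, expressed through `dslope`. -/
theorem dslope_dslope_self {u : ℂ → ℂ} (hu : AnalyticAt ℂ u 0) (h0 : u 0 = 0)
    (h1 : deriv u 0 = 0) :
    dslope (dslope u 0) 0 0 = (1 / 2) * iteratedDeriv 2 u 0 ∧
      ContinuousAt (dslope (dslope u 0) 0) 0 ∧
      ∀ ζ, u ζ = ζ ^ 2 * dslope (dslope u 0) 0 ζ := by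
  obtain ⟨s, hs, hd⟩ : ∃ s ∈ 𝓝 (0 : ℂ), DifferentiableOn ℂ u s := by
    obtain ⟨s, hs, h⟩ := hu.exists_mem_nhds_analyticOnNhd
    exact ⟨s, hs, h.differentiableOn⟩
  set d := dslope (dslope u 0) 0 with hdef
  have hdd : DifferentiableOn ℂ d s :=
    (Complex.differentiableOn_dslope hs).mpr ((Complex.differentiableOn_dslope hs).mpr hd)
  have hda : AnalyticAt ℂ d 0 := hdd.analyticAt hs
  have hmul : ∀ ζ, u ζ = ζ ^ 2 * d ζ := by
    intro ζ
    have e1 := sub_smul_dslope u 0 ζ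
    have e2 := sub_smul_dslope (dslope u 0) 0 ζ
    rw [dslope_same, h1, sub_zero, sub_zero, smul_eq_mul] at e2
    rw [h0, sub_zero, sub_zero, smul_eq_mul, ← e2] at e1
    rw [← e1, hdef]
    ring
  refine ⟨?_, hda.continuousAt, hmul⟩
  have hev : deriv u =ᶠ[𝓝 0] fun ζ => ζ * (2 * d ζ + ζ * deriv d ζ) := by
    filter_upwards [hda.eventually_analyticAt] with ζ hζ
    have e : HasDerivAt (fun ζ => ζ ^ 2 * d ζ) (2 * ζ * d ζ + ζ ^ 2 * deriv d ζ) ζ := by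
      have := (hasDerivAt_pow 2 ζ).fun_mul hζ.differentiableAt.hasDerivAt
      simpa using this
    rw [funext hmul, e.deriv]
    ring
  have hin : DifferentiableAt ℂ (fun ζ => 2 * d ζ + ζ * deriv d ζ) 0 :=
    (hda.differentiableAt.const_mul 2).add (differentiableAt_id.mul hda.deriv.differentiableAt)
  have h2 : HasDerivAt (fun ζ => ζ * (2 * d ζ + ζ * deriv d ζ)) (2 * d 0) 0 := by
    have := (hasDerivAt_id (0 : ℂ)).fun_mul hin.hasDerivAt
    simpa using this
  rw [iteratedDeriv_succ, iteratedDeriv_one, hev.deriv_eq, h2.deriv]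
  ring

theorem hasDerivAt_axis_one (ζ : ℂ) :
    HasDerivAt (fun ζ : ℂ => (!₂[0, ζ] : Cn 2)) !₂[0, 1] ζ := by
  rw [hasDerivAt_euclidean]
  intro i
  fin_cases i
  · simpa using hasDerivAt_const ζ (0 : ℂ)
  · simpa using hasDerivAt_id' ζ

theorem hasDerivAt_axis_zero (ζ : ℂ) :
    HasDerivAt (fun ζ : ℂ => (!₂[ζ, 0] : Cn 2)) !₂[1, 0] ζ := by
  rw [hasDerivAt_euclidean]
  intro i
  fin_cases i
  · simpa using hasDerivAt_id' ζ
  · simpa using hasDerivAt_const ζ (0 : ℂ)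

theorem axis_zero : (!₂[0, 0] : Cn 2) = 0 := by
  ext i
  fin_cases i <;> rfl

theorem axis_mem_unitBall {ζ : ℂ} (hζ : ζ ∈ ball (0 : ℂ) 1) : (!₂[0, ζ] : Cn 2) ∈ unitBall 2 := by
  rw [mem_ball_zero_iff] at hζ
  rw [mem_unitBall_two]
  simpa using hζ

theorem differentiableOn_slice {f : Cn 2 → Cn 2} (hf : DifferentiableOn ℂ f (unitBall 2))
    (i : Fin 2) : DifferentiableOn ℂ (fun ζ : ℂ => f !₂[0, ζ] i) (ball 0 1) := by
  intro ζ hζ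
  have h1 := (hf.differentiableAt ((isOpen_unitBall 2).mem_nhds (axis_mem_unitBall hζ))).comp ζ
    (hasDerivAt_axis_one ζ).differentiableAt
  exact ((EuclideanSpace.proj (𝕜 := ℂ) i).differentiableAt.comp ζ h1).differentiableWithinAt

/-- The coefficient of `ζ²` in the first component of `f` along a curve of the form
`(ζ² g₁(ζ), ζ g₂(ζ))` depends only on the linear part of `f` and on its coefficient of `z₂²`. -/
theorem tendsto_weighted_coeff {f : Cn 2 → Cn 2} (hf : DifferentiableOn ℂ f (unitBall 2))
    (hf0 : f 0 = 0) {c : ℂ} (hfd : HasFDerivAt f (c • ContinuousLinearMap.id ℂ (Cn 2)) 0)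
    {g₁ g₂ : ℂ → ℂ} (h₁ : ContinuousAt g₁ 0) (h₂ : ContinuousAt g₂ 0) :
    Tendsto (fun ζ : ℂ => f !₂[ζ ^ 2 * g₁ ζ, ζ * g₂ ζ] 0 / ζ ^ 2) (𝓝[≠] 0)
      (𝓝 (c * g₁ 0 + coeffA f * g₂ 0 ^ 2)) := by
  have hstrict : HasStrictFDerivAt f (c • ContinuousLinearMap.id ℂ (Cn 2)) 0 := by
    rw [← hfd.fderiv]
    exact hasStrictFDerivAt_of_differentiableOn (isOpen_unitBall 2) hf (zero_mem_unitBall 2)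
  -- the contribution of the second axis
  have hu : AnalyticAt ℂ (fun ζ : ℂ => f !₂[0, ζ] 0) 0 :=
    (differentiableOn_slice hf 0).analyticAt (ball_mem_nhds _ one_pos)
  have hu1 : deriv (fun ζ : ℂ => f !₂[0, ζ] 0) 0 = 0 := by
    have h : HasDerivAt (fun ζ : ℂ => f !₂[0, ζ])
        ((c • ContinuousLinearMap.id ℂ (Cn 2)) !₂[0, 1]) 0 := by
      refine HasFDerivAt.comp_hasDerivAt (l := f) 0 ?_ (hasDerivAt_axis_one 0)
      rwa [axis_zero]
    have := (hasDerivAt_euclidean.mp h 0).deriv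
    simpa using this
  obtain ⟨hd0, hdc, hdm⟩ := dslope_dslope_self hu (by rw [axis_zero, hf0]; rfl) hu1
  set d := dslope (dslope (fun ζ : ℂ => f !₂[0, ζ] 0) 0) 0 with hd
  have hg2 : Tendsto (fun ζ : ℂ => ζ * g₂ ζ) (𝓝 0) (𝓝 0) := by
    have : ContinuousAt (fun ζ : ℂ => ζ * g₂ ζ) 0 := continuousAt_id.mul h₂
    simpa [ContinuousAt] using this
  have hg1 : Tendsto (fun ζ : ℂ => ζ ^ 2 * g₁ ζ) (𝓝 0) (𝓝 0) := by
    have : ContinuousAt (fun ζ : ℂ => ζ ^ 2 * g₁ ζ) 0 := (continuousAt_id.pow 2).mul h₁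
    simpa [ContinuousAt] using this
  have hA : Tendsto (fun ζ : ℂ => g₂ ζ ^ 2 * d (ζ * g₂ ζ)) (𝓝[≠] 0)
      (𝓝 (g₂ 0 ^ 2 * coeffA f)) := by
    refine Tendsto.mono_left ?_ nhdsWithin_le_nhds
    refine (h₂.tendsto.pow 2).mul ?_
    rw [coeffA, ← hd0]
    exact hdc.tendsto.comp hg2
  -- the contribution of the first variable: strict differentiability at `0` gives
  -- `f (w₁, w₂) - f (0, w₂) = (c w₁, 0) + o(w₁)`
  have hcurve : Tendsto (fun ζ : ℂ => ((!₂[ζ ^ 2 * g₁ ζ, ζ * g₂ ζ] : Cn 2),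
      (!₂[0, ζ * g₂ ζ] : Cn 2))) (𝓝 0) (𝓝 (0, 0)) := by
    have hc2 : Continuous (fun p : ℂ × ℂ => (!₂[p.1, p.2] : Cn 2)) := by fun_prop
    refine Tendsto.prodMk_nhds ?_ ?_
    · have := (hc2.tendsto (0, 0)).comp (hg1.prodMk_nhds hg2)
      rwa [axis_zero] at this
    · have := (hc2.tendsto (0, 0)).comp (tendsto_const_nhds.prodMk_nhds hg2)
      rwa [axis_zero] at this
  have hlo := hstrict.isLittleO.comp_tendsto hcurve
  have hdiff : ∀ ζ : ℂ, (!₂[ζ ^ 2 * g₁ ζ, ζ * g₂ ζ] : Cn 2) - !₂[0, ζ * g₂ ζ] =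
      !₂[ζ ^ 2 * g₁ ζ, 0] := by
    intro ζ
    ext i
    fin_cases i <;> simp
  have hO : (fun ζ : ℂ => (!₂[ζ ^ 2 * g₁ ζ, ζ * g₂ ζ] : Cn 2) - !₂[0, ζ * g₂ ζ]) =O[𝓝 0]
      fun ζ : ℂ => ζ ^ 2 := by
    have e1 : (fun ζ : ℂ => ζ ^ 2 * g₁ ζ) =O[𝓝 0] fun ζ : ℂ => ζ ^ 2 * 1 :=
      (Asymptotics.isBigO_refl _ _).mul (h₁.tendsto.isBigO_one ℂ)
    simp only [mul_one] at e1
    refine Asymptotics.IsBigO.trans (Asymptotics.isBigO_of_le _ fun ζ => ?_) e1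
    rw [hdiff, EuclideanSpace.norm_eq, Fin.sum_univ_two]
    simp [Real.sqrt_sq_eq_abs]
  have hlo2 := hlo.trans_isBigO hO
  have hR : Tendsto (fun ζ : ℂ => (f !₂[ζ ^ 2 * g₁ ζ, ζ * g₂ ζ] 0 - f !₂[0, ζ * g₂ ζ] 0 -
      c * (ζ ^ 2 * g₁ ζ)) / ζ ^ 2) (𝓝[≠] 0) (𝓝 0) := by
    have e1 : (fun ζ : ℂ => f !₂[ζ ^ 2 * g₁ ζ, ζ * g₂ ζ] 0 - f !₂[0, ζ * g₂ ζ] 0 -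
      c * (ζ ^ 2 * g₁ ζ)) =o[𝓝 0] fun ζ : ℂ => ζ ^ 2 := by
      refine Asymptotics.IsBigO.trans_isLittleO (Asymptotics.isBigO_of_le _ fun ζ => ?_) hlo2
      refine le_trans (le_of_eq ?_) (PiLp.norm_apply_le _ (0 : Fin 2))
      simp
    exact (e1.mono nhdsWithin_le_nhds).tendsto_div_nhds_zero
  have hg1' : Tendsto (fun ζ : ℂ => c * g₁ ζ) (𝓝[≠] 0) (𝓝 (c * g₁ 0)) :=
    (h₁.tendsto.const_mul c).mono_left nhdsWithin_le_nhds
  have hsum := (hR.add hg1').add hA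
  rw [zero_add, mul_comm (g₂ 0 ^ 2)] at hsum
  refine hsum.congr' ?_
  filter_upwards [self_mem_nhdsWithin] with ζ hζ
  have hζ : ζ ≠ 0 := hζ
  have e := hdm (ζ * g₂ ζ)
  simp only at e
  rw [e]
  field_simp
  ring

/-- The key estimate. Let `φ = g⁻¹ ∘ f` be the transition map and `z` a point of the ball. The map
`ζ ↦ (ζ⁻² φ₁(ζ² z₁, ζ z₂), ζ⁻¹ φ₂(ζ² z₁, ζ z₂))` extends holomorphically to `ζ = 0`, its value there
is the shearing of `φ` at `z`, and it takes the unit circle into the ball, because the torus action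
`(ζ², ζ)` is unitary. By the maximum principle the shearing of `φ` maps the ball into itself. -/
theorem shearing_transition_mem {f g : Cn 2 → Cn 2} (hf : IsUnivalent f) (hg : IsUnivalent g)
    (hf0 : f 0 = 0) (hg0 : g 0 = 0) {c c' : ℂ} (hc' : c' ≠ 0)
    (hfd : HasFDerivAt f (c • ContinuousLinearMap.id ℂ (Cn 2)) 0)
    (hgd : HasFDerivAt g (c' • ContinuousLinearMap.id ℂ (Cn 2)) 0)
    (hsub : f '' unitBall 2 ⊆ g '' unitBall 2) {z : Cn 2} (hz : z ∈ unitBall 2) :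
    ∃ w ∈ unitBall 2, c' * w 0 + coeffA g * w 1 ^ 2 = c * z 0 + coeffA f * z 1 ^ 2 ∧
      c' * w 1 = c * z 1 := by
  obtain ⟨φ, hφm, hφd, hφg, hφ0, hφ'⟩ := exists_transition hf hg hf0 hg0 hc' hfd hgd hsub
  have hO := isOpen_unitBall 2
  set κ : ℂ → Cn 2 := fun ζ => !₂[ζ ^ 2 * z 0, ζ * z 1] with hκ
  have hκd : ∀ ζ, HasDerivAt κ !₂[2 * ζ * z 0, z 1] ζ := by
    intro ζ
    rw [hasDerivAt_euclidean]
    intro i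
    fin_cases i
    · simpa [hκ] using (hasDerivAt_pow 2 ζ).mul_const (z 0)
    · simpa [hκ] using (hasDerivAt_id ζ).mul_const (z 1)
  have hκc : Continuous κ := continuous_iff_continuousAt.mpr fun ζ => (hκd ζ).continuousAt
  have hκ0 : κ 0 = 0 := by
    ext i
    fin_cases i <;> simp [hκ]
  have hVo : IsOpen (κ ⁻¹' unitBall 2) := hO.preimage hκc
  have hV : closedBall (0 : ℂ) 1 ⊆ κ ⁻¹' unitBall 2 := by
    intro ζ hζ
    rw [mem_closedBall_zero_iff] at hζ
    rw [mem_preimage, mem_unitBall_two]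
    rw [mem_unitBall_two] at hz
    refine lt_of_le_of_lt (add_le_add ?_ ?_) hz
    · simp only [hκ, PiLp.toLp_apply, Matrix.cons_val_zero, norm_mul, norm_pow]
      gcongr
      exact mul_le_of_le_one_left (norm_nonneg _) (pow_le_one₀ (norm_nonneg _) hζ)
    · simp only [hκ, PiLp.toLp_apply, Matrix.cons_val_one, Matrix.cons_val_fin_one, norm_mul]
      gcongr
      exact mul_le_of_le_one_left (norm_nonneg _) hζ
  have h0V : κ ⁻¹' unitBall 2 ∈ 𝓝 (0 : ℂ) :=
    hVo.mem_nhds (hV (mem_closedBall_self zero_le_one))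
  have hγd : ∀ i : Fin 2, DifferentiableOn ℂ (fun ζ => φ (κ ζ) i) (κ ⁻¹' unitBall 2) := by
    intro i ζ hζ
    have h1 := (hφd.differentiableAt (hO.mem_nhds hζ)).comp ζ (hκd ζ).differentiableAt
    exact ((EuclideanSpace.proj (𝕜 := ℂ) i).differentiableAt.comp ζ h1).differentiableWithinAt
  have hγ' : HasDerivAt (fun ζ => φ (κ ζ))
      (((c / c') • ContinuousLinearMap.id ℂ (Cn 2)) !₂[2 * 0 * z 0, z 1]) 0 := by
    refine HasFDerivAt.comp_hasDerivAt (l := φ) 0 ?_ (hκd 0)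
    rwa [hκ0]
  have hγ1 := (hasDerivAt_euclidean.mp hγ' 0).deriv
  have hγ2 := (hasDerivAt_euclidean.mp hγ' 1).deriv
  simp only [mul_zero, zero_mul, _root_.smul_apply, ContinuousLinearMap.id_apply,
    PiLp.smul_apply, Matrix.cons_val_zero, Matrix.cons_val_one, smul_eq_mul]
    at hγ1 hγ2
  have hz0 : ∀ i : Fin 2, φ (κ 0) i = 0 := fun i => by rw [hκ0, hφ0]; rfl
  obtain ⟨-, hg₁c, hg₁⟩ := dslope_dslope_self ((hγd 0).analyticAt h0V) (hz0 0) hγ1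
  set g₁ := dslope (dslope (fun ζ => φ (κ ζ) 0) 0) 0 with hg₁def
  set g₂ := dslope (fun ζ => φ (κ ζ) 1) 0 with hg₂def
  have hg₁d : DifferentiableOn ℂ g₁ (κ ⁻¹' unitBall 2) :=
    (Complex.differentiableOn_dslope h0V).mpr ((Complex.differentiableOn_dslope h0V).mpr (hγd 0))
  have hg₂d : DifferentiableOn ℂ g₂ (κ ⁻¹' unitBall 2) :=
    (Complex.differentiableOn_dslope h0V).mpr (hγd 1)
  have hg₂c : ContinuousAt g₂ 0 := (hg₂d.differentiableAt h0V).continuousAt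
  have hg₂ : ∀ ζ, φ (κ ζ) 1 = ζ * g₂ ζ := by
    intro ζ
    have := sub_smul_dslope (fun ζ => φ (κ ζ) 1) 0 ζ
    rw [sub_zero, hz0 1, sub_zero, smul_eq_mul] at this
    exact this.symm
  have hg₂0 : g₂ 0 = c / c' * z 1 := by rw [hg₂def, dslope_same, hγ2]
  set G : ℂ → Cn 2 := fun ζ => !₂[g₁ ζ, g₂ ζ] with hG
  have hGd : DifferentiableOn ℂ G (κ ⁻¹' unitBall 2) := by
    rw [differentiableOn_euclidean]
    intro i
    fin_cases i
    · simpa [hG] using hg₁d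
    · simpa [hG] using hg₂d
  have hφG : ∀ ζ, φ (κ ζ) = !₂[ζ ^ 2 * g₁ ζ, ζ * g₂ ζ] := by
    intro ζ
    ext i
    fin_cases i
    · simpa using hg₁ ζ
    · simpa using hg₂ ζ
  have hcirc : ∀ ζ ∈ sphere (0 : ℂ) 1, ‖G ζ‖ < 1 := by
    intro ζ hζ
    have h1 := hφm (hV (sphere_subset_closedBall hζ))
    rw [mem_sphere_zero_iff_norm] at hζ
    rw [hφG, mem_unitBall_two] at h1
    rw [← mem_ball_zero_iff]
    change G ζ ∈ unitBall 2
    rw [mem_unitBall_two]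
    simpa [hζ, hG] using h1
  have hG0 : G 0 ∈ unitBall 2 := by
    obtain ⟨ζ₀, hζ₀, hmax⟩ := (isCompact_sphere (0 : ℂ) 1).exists_isMaxOn
      (NormedSpace.sphere_nonempty.mpr zero_le_one) (f := fun ζ => ‖G ζ‖)
      ((hGd.continuousOn.mono (sphere_subset_closedBall.trans hV)).norm)
    have := Complex.norm_le_of_forall_mem_frontier_norm_le (isBounded_ball (x := (0 : ℂ)))
      ((hGd.mono hV).diffContOnCl_ball subset_rfl) (C := ‖G ζ₀‖) (fun ζ hζ => by
        rw [frontier_ball _ one_ne_zero] at hζ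
        exact hmax hζ) (subset_closure (mem_ball_self one_pos))
    rw [unitBall, mem_ball_zero_iff]
    exact this.trans_lt (hcirc ζ₀ hζ₀)
  refine ⟨G 0, hG0, ?_, ?_⟩
  · have l1 := tendsto_weighted_coeff hg.1 hg0 hgd hg₁c hg₂c
    have l2 := tendsto_weighted_coeff hf.1 hf0 hfd
      (continuousAt_const (y := z 0)) (continuousAt_const (y := z 1))
    refine tendsto_nhds_unique l1 (l2.congr' ?_)
    filter_upwards [nhdsWithin_le_nhds h0V] with ζ hζ
    rw [← hφG, hφg _ hζ]
  · simp only [hG, Matrix.cons_val_one, Matrix.cons_val_fin_one, hg₂0]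
    field_simp

/-! ### The shearing of a Loewner chain -/

theorem coeffLam_eq {f : Cn 2 → Cn 2} {c : ℂ}
    (hfd : HasFDerivAt f (c • ContinuousLinearMap.id ℂ (Cn 2)) 0) : coeffLam f = c := by
  have h : HasDerivAt (fun ζ : ℂ => f !₂[ζ, 0])
      ((c • ContinuousLinearMap.id ℂ (Cn 2)) !₂[1, 0]) 0 := by
    refine HasFDerivAt.comp_hasDerivAt (l := f) 0 ?_ (hasDerivAt_axis_zero 0)
    rwa [axis_zero]
  have := (hasDerivAt_euclidean.mp h 0).deriv
  simpa [coeffLam] using this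

theorem coeffMu_eq {f : Cn 2 → Cn 2} {c : ℂ}
    (hfd : HasFDerivAt f (c • ContinuousLinearMap.id ℂ (Cn 2)) 0) : coeffMu f = c := by
  have h : HasDerivAt (fun ζ : ℂ => f !₂[0, ζ])
      ((c • ContinuousLinearMap.id ℂ (Cn 2)) !₂[0, 1]) 0 := by
    refine HasFDerivAt.comp_hasDerivAt (l := f) 0 ?_ (hasDerivAt_axis_one 0)
    rwa [axis_zero]
  have := (hasDerivAt_euclidean.mp h 1).deriv
  simpa [coeffMu] using this

theorem shearing_apply {f : Cn 2 → Cn 2} {c : ℂ}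
    (hfd : HasFDerivAt f (c • ContinuousLinearMap.id ℂ (Cn 2)) 0) (z : Cn 2) :
    shearing f z = !₂[c * z 0 + coeffA f * z 1 ^ 2, c * z 1] := by
  rw [shearing, coeffLam_eq hfd, coeffMu_eq hfd]

theorem shearing_zero (f : Cn 2 → Cn 2) : shearing f 0 = 0 := by
  ext i
  fin_cases i <;> simp [shearing]

theorem differentiable_shearing (f : Cn 2 → Cn 2) : Differentiable ℂ (shearing f) := by
  have hp : ∀ i : Fin 2, Differentiable ℂ (fun z : Cn 2 => z i) := fun i =>
    (EuclideanSpace.proj (𝕜 := ℂ) i).differentiable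
  rw [differentiable_euclidean]
  intro i
  fin_cases i
  · simpa [shearing] using ((hp 0).const_mul (coeffLam f)).fun_add
      (((hp 1).pow 2).const_mul (coeffA f))
  · simpa [shearing] using (hp 1).const_mul (coeffMu f)

theorem isUnivalent_shearing {f : Cn 2 → Cn 2} {c : ℂ} (hc : c ≠ 0)
    (hfd : HasFDerivAt f (c • ContinuousLinearMap.id ℂ (Cn 2)) 0) : IsUnivalent (shearing f) := by
  refine ⟨(differentiable_shearing f).differentiableOn, fun z _ w _ h => ?_⟩
  rw [shearing_apply hfd, shearing_apply hfd] at h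
  have h0 := congrArg (fun v : Cn 2 => v 0) h
  have h1 := congrArg (fun v : Cn 2 => v 1) h
  simp only [Matrix.cons_val_zero, Matrix.cons_val_one,
    Matrix.cons_val_fin_one] at h0 h1
  have e1 : z 1 = w 1 := mul_left_cancel₀ hc h1
  rw [e1] at h0
  have e0 : z 0 = w 0 := mul_left_cancel₀ hc (add_right_cancel h0)
  ext i
  fin_cases i
  · exact e0
  · exact e1

theorem hasFDerivAt_shearing {f : Cn 2 → Cn 2} {c : ℂ}
    (hfd : HasFDerivAt f (c • ContinuousLinearMap.id ℂ (Cn 2)) 0) :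
    HasFDerivAt (shearing f) (c • ContinuousLinearMap.id ℂ (Cn 2)) 0 := by
  have hp : ∀ i : Fin 2, HasFDerivAt (fun z : Cn 2 => z i)
      (EuclideanSpace.proj i : Cn 2 →L[ℂ] ℂ) 0 := fun i =>
    (EuclideanSpace.proj (𝕜 := ℂ) i).hasFDerivAt
  rw [hasFDerivAt_euclidean]
  intro i
  fin_cases i
  · have h := ((hp 0).const_mul c).add (((hp 1).pow 2).const_mul (coeffA f))
    refine (h.congr_fderiv ?_).congr_of_eventuallyEq (Eventually.of_forall fun z => ?_)
    · ext v
      simp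
    · simp [shearing_apply hfd]
  · refine (((hp 1).const_mul c).congr_fderiv ?_).congr_of_eventuallyEq
      (Eventually.of_forall fun z => ?_)
    · ext v
      simp
    · simp [shearing_apply hfd]

theorem image_shearing_subset {f g : Cn 2 → Cn 2} (hf : IsUnivalent f) (hg : IsUnivalent g)
    (hf0 : f 0 = 0) (hg0 : g 0 = 0) {c c' : ℂ} (hc' : c' ≠ 0)
    (hfd : HasFDerivAt f (c • ContinuousLinearMap.id ℂ (Cn 2)) 0)
    (hgd : HasFDerivAt g (c' • ContinuousLinearMap.id ℂ (Cn 2)) 0)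
    (hsub : f '' unitBall 2 ⊆ g '' unitBall 2) :
    shearing f '' unitBall 2 ⊆ shearing g '' unitBall 2 := by
  rintro _ ⟨z, hz, rfl⟩
  obtain ⟨w, hw, h0, h1⟩ := shearing_transition_mem hf hg hf0 hg0 hc' hfd hgd hsub hz
  exact ⟨w, hw, by rw [shearing_apply hfd, shearing_apply hgd, h0, h1]⟩

/-- The shearing depends only on the germ at `0`. -/
theorem shearing_congr {f g : Cn 2 → Cn 2} (h : EqOn f g (unitBall 2)) :
    shearing f = shearing g := by
  have hO := isOpen_unitBall 2
  have h0 : ∀ᶠ ζ : ℂ in 𝓝 0, f !₂[ζ, 0] = g !₂[ζ, 0] := by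
    filter_upwards [(hasDerivAt_axis_zero 0).continuousAt.eventually_mem
      (by rw [axis_zero]; exact hO.mem_nhds (zero_mem_unitBall 2))] with ζ hζ
    exact h hζ
  have h1 : ∀ᶠ ζ : ℂ in 𝓝 0, f !₂[0, ζ] = g !₂[0, ζ] := by
    filter_upwards [(hasDerivAt_axis_one 0).continuousAt.eventually_mem
      (by rw [axis_zero]; exact hO.mem_nhds (zero_mem_unitBall 2))] with ζ hζ
    exact h hζ
  have eL : coeffLam f = coeffLam g :=
    Filter.EventuallyEq.deriv_eq (h0.mono fun ζ hζ => by simp only [hζ])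
  have eM : coeffMu f = coeffMu g :=
    Filter.EventuallyEq.deriv_eq (h1.mono fun ζ hζ => by simp only [hζ])
  have eA : coeffA f = coeffA g := by
    have : iteratedDeriv 2 (fun ζ : ℂ => f !₂[0, ζ] 0) 0 =
        iteratedDeriv 2 (fun ζ : ℂ => g !₂[0, ζ] 0) 0 :=
      Filter.EventuallyEq.iteratedDeriv_eq 2 (h1.mono fun ζ hζ => by simp only [hζ])
    rw [coeffA, coeffA, this]
  funext z
  rw [shearing, shearing, eL, eM, eA]

/-- The coefficient `A` is continuous for uniform convergence on compact subsets of the ball. -/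
theorem tendsto_coeffA {F : ℕ → Cn 2 → Cn 2} {g : Cn 2 → Cn 2}
    (hF : ∀ j, DifferentiableOn ℂ (F j) (unitBall 2))
    (hlim : ∀ K : Set (Cn 2), IsCompact K → K ⊆ unitBall 2 → TendstoUniformlyOn F g atTop K) :
    Tendsto (fun j => coeffA (F j)) atTop (𝓝 (coeffA g)) := by
  have h1 : TendstoLocallyUniformlyOn (fun j (ζ : ℂ) => F j !₂[0, ζ] 0)
      (fun ζ : ℂ => g !₂[0, ζ] 0) atTop (ball 0 1) := by
    rw [tendstoLocallyUniformlyOn_iff_forall_isCompact isOpen_ball]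
    intro K hK1 hK
    have hcont : Continuous (fun ζ : ℂ => (!₂[0, ζ] : Cn 2)) := by fun_prop
    have h2 := hlim _ (hK.image hcont) (by
      rintro _ ⟨ζ, hζ, rfl⟩
      exact axis_mem_unitBall (hK1 hζ))
    rw [Metric.tendstoUniformlyOn_iff] at h2 ⊢
    intro ε hε
    filter_upwards [h2 ε hε] with j hj ζ hζ
    refine lt_of_le_of_lt ?_ (hj _ (mem_image_of_mem _ hζ))
    rw [dist_eq_norm, dist_eq_norm]
    exact PiLp.norm_apply_le (g !₂[0, ζ] - F j !₂[0, ζ]) (0 : Fin 2)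
  have hd : ∀ j, DifferentiableOn ℂ (fun ζ : ℂ => F j !₂[0, ζ] 0) (ball 0 1) := fun j =>
    differentiableOn_slice (hF j) 0
  have h3 := (h1.deriv (Eventually.of_forall hd) isOpen_ball).deriv
    (Eventually.of_forall fun j => (hd j).deriv isOpen_ball) isOpen_ball
  have h4 := (h3.tendsto_at (mem_ball_self one_pos)).const_mul (1 / 2)
  simpa only [coeffA, Function.comp_apply, iteratedDeriv_succ, iteratedDeriv_zero] using h4

theorem coeffA_const_smul (f : Cn 2 → Cn 2) (c : ℂ) :
    coeffA (fun z => c • f z) = c * coeffA f := by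
  simp only [coeffA, PiLp.smul_apply, smul_eq_mul, iteratedDeriv_const_mul_field]
  ring

theorem IsNormalLoewnerChain.shearing {f : ℝ≥0 → Cn 2 → Cn 2} (hf : IsNormalLoewnerChain f) :
    IsNormalLoewnerChain (fun t => Shearing.shearing (f t)) where
  univalent t := isUnivalent_shearing (by exact_mod_cast (Real.exp_pos _).ne')
    (hf.hasFDerivAt_zero t)
  image_subset s t hst := image_shearing_subset (hf.univalent s) (hf.univalent t)
    (hf.map_zero s) (hf.map_zero t) (by exact_mod_cast (Real.exp_pos _).ne')
    (hf.hasFDerivAt_zero s) (hf.hasFDerivAt_zero t) (hf.image_subset s t hst)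
  map_zero t := shearing_zero (f t)
  hasFDerivAt_zero t := hasFDerivAt_shearing (hf.hasFDerivAt_zero t)
  normal := by
    intro u
    obtain ⟨k, hk, g, hg⟩ := hf.normal u
    refine ⟨k, hk, fun z => !₂[z 0 + coeffA g * z 1 ^ 2, z 1], fun K _ hK => ?_⟩
    have hlim := tendsto_coeffA (fun j => (hf.univalent (u (k j))).1.const_smul
      ((Real.exp (-(u (k j) : ℝ)) : ℝ) : ℂ)) hg
    rw [Metric.tendstoUniformlyOn_iff]
    intro ε hε
    filter_upwards [Metric.tendsto_nhds.mp hlim ε hε] with j hj z hz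
    have hexp : ((Real.exp (-(u (k j) : ℝ)) : ℝ) : ℂ) * ((Real.exp (u (k j) : ℝ) : ℝ) : ℂ) = 1 := by
      rw [← Complex.ofReal_mul, ← Real.exp_add, neg_add_cancel, Real.exp_zero, Complex.ofReal_one]
    have hsh : ((Real.exp (-(u (k j) : ℝ)) : ℝ) : ℂ) • Shearing.shearing (f (u (k j))) z =
        !₂[z 0 + coeffA (fun z => ((Real.exp (-(u (k j) : ℝ)) : ℝ) : ℂ) • f (u (k j)) z) *
          z 1 ^ 2, z 1] := by
      rw [coeffA_const_smul, shearing_apply (hf.hasFDerivAt_zero _)]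
      ext i
      fin_cases i
      · simp only [PiLp.smul_apply, Fin.zero_eta, Matrix.cons_val_zero,
          smul_eq_mul]
        linear_combination (z 0) * hexp
      · simp only [PiLp.smul_apply, Fin.mk_one, Matrix.cons_val_one,
          Matrix.cons_val_fin_one, smul_eq_mul]
        linear_combination (z 1) * hexp
    rw [hsh]
    set a := coeffA (fun z => ((Real.exp (-(u (k j) : ℝ)) : ℝ) : ℂ) • f (u (k j)) z)
    have hz1 : ‖z 1‖ ≤ 1 := by
      have := hK hz
      rw [mem_unitBall_two] at this
      nlinarith [sq_nonneg ‖z 0‖, norm_nonneg (z 1)]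
    have e : (!₂[z 0 + coeffA g * z 1 ^ 2, z 1] : Cn 2) - !₂[z 0 + a * z 1 ^ 2, z 1] =
        ((coeffA g - a) * z 1 ^ 2) • !₂[1, 0] := by
      ext i
      fin_cases i
      · simp
        ring
      · simp
    have e1 : ‖(!₂[1, 0] : Cn 2)‖ = 1 := by
      rw [EuclideanSpace.norm_eq, Fin.sum_univ_two]
      simp
    rw [dist_eq_norm, e, norm_smul, e1, mul_one, norm_mul, norm_pow]
    calc ‖coeffA g - a‖ * ‖z 1‖ ^ 2 ≤ ‖coeffA g - a‖ * 1 := by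
          gcongr
          exact pow_le_one₀ (norm_nonneg _) hz1
      _ = dist a (coeffA g) := by rw [mul_one, dist_comm, dist_eq_norm]
      _ < ε := hj

theorem shearing_mem_classS0 {f : Cn 2 → Cn 2} (hf : f ∈ classS0 2) :
    shearing f ∈ classS0 2 := by
  obtain ⟨⟨-, -, hfd⟩, F, hF, hF0⟩ := hf
  rw [← one_smul ℂ (ContinuousLinearMap.id ℂ (Cn 2))] at hfd
  refine ⟨⟨isUnivalent_shearing one_ne_zero hfd, shearing_zero f, ?_⟩, _, hF.shearing, ?_⟩
  · simpa using hasFDerivAt_shearing hfd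
  · intro z _
    simp only [shearing_congr hF0]

end Shearing

theorem theorem1p3 :
    (∀ f : ℝ≥0 → Shearing.Cn 2 → Shearing.Cn 2, Shearing.IsNormalLoewnerChain f →
      Shearing.IsNormalLoewnerChain (fun t => Shearing.shearing (f t))) ∧
    (∀ f : Shearing.Cn 2 → Shearing.Cn 2, f ∈ Shearing.classS0 2 →
      Shearing.shearing f ∈ Shearing.classS0 2) :=
  ⟨fun _ hf => hf.shearing, fun _ hf => Shearing.shearing_mem_classS0 hf⟩
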